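/- **Definitions.** A *Σ-subset* of a compact Hausdorff space $K$ is a set of the form $\varphi^{-1}[\Sigma(\Gamma)]$, where $\Gamma$ is a set, $\varphi:K\to\mathbb R^\Gamma$ is a continuous injection (product topology) and $\Sigma(\Gamma)$ is the set of $x\in\mathbb R^\Gamma$ with $\{\gamma\in\Gamma:x_\gamma\ne0\}$ countable. A *Valdivia compactum* is a compact Hausdorff space having a dense Σ-subset; $w(K)$ denotes the weight of $K$. A *tree* is a partially ordered set $T$ in which $\{s\in T:s<t\}$ is well-ordered for every $t\in T$. A *path* of $T$ is a chain $A\subset T$ such that $s<t\in A$ implies $s\in A$; $P^*(T)$ is the set of nonempty paths of $T$. A *graded tree* $(T,\delta)$ is a tree $T$ with a map $\delta$ from $T$ to the class consisting of $0$ and all successor ordinals such that $\delta(t)=0$ for every minimal $t\in T$, and $\delta(t)<\delta(s)$ whenever $t<s$; it is *$\omega_1$-graded* if $\delta(t)<\omega_1$ for all $t\in T$. For an ordinal $\alpha$ put $T_\alpha=\{t\in T:\delta(t)\le\alpha\}$ (so $P^*(T_\alpha)$ is the set of those $A\in P^*(T)$ with $A\subset T_\alpha$) and $\rho_\alpha:P^*(T)\to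 P^*(T)$, $\rho_\alpha(A)=A\cap T_\alpha$. A *compatible topology* on $P^*(T)$ is a compact Hausdorff topology for which $\rho_\alpha$ is continuous for every ordinal $\alpha$; the sets $P^*(T_\alpha)$ then carry the subspace topology. **Theorem.** Let $K$ be a Valdivia compactum with $w(K)\le\omega_1$ and let $S$ be a dense Σ-subset of $K$. Then there exist an $\omega_1$-graded tree $(T,\delta)$, a compatible topology on $P^*(T)$ such that $P^*(T_\alpha)$ is metrizable for all $\alpha<\omega_1$, and a homeomorphism between $K$ and $P^*(T)$ that carries $S$ to the set $$\bigcup_{\alpha<\omega_1}P^*(T_\alpha)=\{A\in P^*(T):A\text{ is countable}\}.\qquad(*)$$ Conversely, given an $\omega_1$-graded tree $(T,\delta)$ and a compatible topology on $P^*(T)$ such that $P^*(T_\alpha)$ is metrizable for all $\alpha<\omega_1$, the equality $(*)$ holds, $P^*(T)$ is a Valdivia compactum with $w(P^*(T))\le\omega_1$, and the set $(*)$ is a dense Σ-subset of $P^*(T)$. -/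

import Mathlib

open scoped Ordinal Cardinal

universe u

namespace SmallValdivia

/-- The weight of a topological space: the least cardinality of a base of its topology. -/
noncomputable def weight (X : Type u) [TopologicalSpace X] : Cardinal.{u} :=
  sInf {c | ∃ B : Set (Set X), TopologicalSpace.IsTopologicalBasis B ∧ Cardinal.mk B = c}

/-- The `Σ`-product `Σ(Γ)`: the points of `ℝ^Γ` with countably many nonzero coordinates. -/
def sigmaProduct (Γ : Type u) : Set (Γ → ℝ) :=
  {x | {γ | x γ ≠ 0}.Countable}

/-- `S` is a `Σ`-subset of `K`: it is the preimage of some `Σ(Γ)` under a continuous injection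
of `K` into `ℝ^Γ` with the product topology. (Index sets in the universe of `K` suffice: only the
countability of sets of indices matters, so each of the continuous functions `K → ℝ` needs to occur
as a coordinate at most `ℵ₁` times.) -/
def IsSigmaSubset {K : Type u} [TopologicalSpace K] (S : Set K) : Prop :=
  ∃ (Γ : Type u) (φ : K → Γ → ℝ),
    Continuous φ ∧ Function.Injective φ ∧ S = φ ⁻¹' sigmaProduct Γ

/-- A Valdivia compactum: a compact Hausdorff space with a dense `Σ`-subset. -/
def IsValdiviaCompactum (K : Type u) [TopologicalSpace K] : Prop :=
  CompactSpace K ∧ T2Space K ∧ ∃ S : Set K, Dense S ∧ IsSigmaSubset S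

/-- A path of a partially ordered set: a chain that is also an initial part. -/
def IsPath {T : Type u} [PartialOrder T] (A : Set T) : Prop :=
  IsChain (· ≤ ·) A ∧ ∀ t ∈ A, Set.Iio t ⊆ A

/-- The path space `P*(T)`: the set of nonempty paths of `T` (with no topology yet). -/
def PathSpace (T : Type u) [PartialOrder T] : Type u :=
  {A : Set T // A.Nonempty ∧ IsPath A}

/-- A graded tree on the partially ordered set `T`: all the sets `{s | s < t}` are well-ordered,
and `grade` is a strictly increasing map to the zero and successor ordinals that vanishes at the
minimal elements. -/
structure GradedTree (T : Type u) [PartialOrder T] where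
  wellOrdered_Iio : ∀ t : T, IsWellOrder (Set.Iio t) (· < ·)
  grade : T → Ordinal.{u}
  grade_zero_or_succ : ∀ t, grade t = 0 ∨ ∃ β, grade t = Order.succ β
  grade_of_isMin : ∀ t, IsMin t → grade t = 0
  grade_lt : ∀ s t, s < t → grade s < grade t

namespace GradedTree

/-- The graded tree is `θ`-graded: all grades are smaller than `θ`. -/
def IsGradedBelow {T : Type u} [PartialOrder T] (G : GradedTree T) (θ : Ordinal.{u}) : Prop :=
  ∀ t, G.grade t < θ

/-- The initial subtree `T_α` of the elements of grade at most `α`. -/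
def level {T : Type u} [PartialOrder T] (G : GradedTree T) (α : Ordinal.{u}) : Set T :=
  {t | G.grade t ≤ α}

/-- The subset `P*(T_α)` of `P*(T)`. As `T_α` is an initial part of `T`, its nonempty paths are
precisely the nonempty paths of `T` that are contained in `T_α`. -/
def levelPaths {T : Type u} [PartialOrder T] (G : GradedTree T) (α : Ordinal.{u}) : Set (PathSpace T) :=
  {A | A.1 ⊆ G.level α}

theorem exists_isMin_mem {T : Type u} [PartialOrder T] (G : GradedTree T) {A : Set T} (hA : A.Nonempty) (hp : IsPath A) : ∃ m ∈ A, IsMin m := by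
  obtain ⟨t, ht⟩ := hA
  by_cases hmin : IsMin t
  · exact ⟨t, ht, hmin⟩
  · obtain ⟨s, hs⟩ := not_isMin_iff.1 hmin
    have hw := G.wellOrdered_Iio t
    have wf : WellFounded ((· < ·) : Set.Iio t → Set.Iio t → Prop) := hw.wf
    obtain ⟨m, -, hm⟩ := wf.has_min Set.univ ⟨⟨s, hs⟩, trivial⟩
    refine ⟨m.1, hp.2 t ht m.2, fun b hb => ?_⟩
    by_contra hcon
    have hlt : b < m.1 := lt_of_le_not_ge hb hcon
    exact hm ⟨b, hlt.trans m.2⟩ trivial hlt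

/-- The map `ρ_α : P*(T) → P*(T)`, `A ↦ A ∩ T_α`. -/
def restrict {T : Type u} [PartialOrder T] (G : GradedTree T) (α : Ordinal.{u})
    (A : PathSpace T) : PathSpace T :=
  ⟨A.1 ∩ G.level α, by
    obtain ⟨m, hm, hmin⟩ := G.exists_isMin_mem A.2.1 A.2.2
    refine ⟨m, hm, ?_⟩
    change G.grade m ≤ α
    rw [G.grade_of_isMin m hmin]
    exact bot_le,
   A.2.2.1.mono Set.inter_subset_left,
   fun t ht s hs => ⟨A.2.2.2 t ht.1 hs, (G.grade_lt s t hs).le.trans ht.2⟩⟩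

/-- A compatible topology on `P*(T)`: compact, Hausdorff, and making every `ρ_α` continuous. -/
def IsCompatible {T : Type u} [PartialOrder T] (G : GradedTree T)
    (τ : TopologicalSpace (PathSpace T)) : Prop :=
  CompactSpace (PathSpace T) ∧ T2Space (PathSpace T) ∧
    ∀ α : Ordinal.{u}, Continuous (G.restrict α)

end GradedTree

end SmallValdivia

/-!
Both directions pass through a system of commuting retractions `r_α` of a compact space `K`, with
increasing images, continuous at limit ordinals and with `r_{ω₁} = id`.

*From a space to a tree.* Let `φ : K → ℝ^Γ` be a continuous injection and let `S`, the set of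
points with countable support, be dense. Coordinates that vanish on all of `K` may be dropped, and
by the bound on the weight at most `ℵ₁` remain; enumerate them by countable ordinals. A
Löwenheim–Skolem closure argument gives a countable-set-valued operation `c` on the finite subsets of
`Γ` such that setting the coordinates outside a `c`-closed set `M` to zero maps `φ(K)` into itself
(`exists_support_operation`). The least closed set containing the first `α` coordinates is countable
for `α < ω₁` and continuous in `α`, so the corresponding retractions `r_α` form the required
system, with metrizable images whose union is `S` (`exists_retractionSystem`). The tree consists of
the points `t` whose rank, the least `α` with `r_α t = t`, is zero or a successor, where `s ≤ t`
means that `s` is the image of `t` under the retraction indexed by the rank of `s`. Sending `x` to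
the set of nodes of the form `r_α x` is a bijection onto the nonempty paths: it is injective because
the least `α` at which two points are told apart is not a limit, and surjective by compactness. It
turns `r_α` into `ρ_α`, so the topology of `K` is carried over to a compatible one
(`RetractionSystem.exists_homeomorph`).

*From a tree to a space.* A path is countable exactly if its grades are bounded below `ω₁`. Every
path `A` is a limit of its restrictions `ρ_α A`, by compactness, so the countable paths are dense.
The coordinates of a `Σ`-embedding are a separating sequence for `P*(T_0)` and, for each `β < ω₁`, the
differences `F ∘ ρ_{β+1} - F ∘ ρ_β`, with `F` in a separating sequence for `P*(T_{β+1})`. The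
differences at `β` all vanish at `A` just if `A` has no element of grade `β + 1`; hence the support is
countable if and only if `A` is (`GradedTree.exists_sigma_injection`). The index set has size `ℵ₁`,
which bounds the weight.
-/

namespace SmallValdivia

/-! ### Countable ordinals -/

theorem countable_Iio_of_lt_omega_one {α : Ordinal.{u}} (h : α < ω₁) : (Set.Iio α).Countable := by
  rw [← Cardinal.le_aleph0_iff_set_countable, Cardinal.mk_Iio_ordinal, Cardinal.lift_le_aleph0]
  have h' : α < (ℵ₁ : Cardinal.{u}).ord := by rwa [Cardinal.ord_aleph]
  rw [Cardinal.lt_ord, ← Cardinal.succ_aleph0, Order.lt_succ_iff] at h'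
  exact h'

theorem isSuccLimit_omega_one : Order.IsSuccLimit (ω₁ : Ordinal.{u}) :=
  Cardinal.isSuccLimit_omega 1

/-- Every countable set of countable ordinals has a strict upper bound below `ω₁`. -/
theorem exists_lt_omega_one_of_countable {s : Set Ordinal.{u}} (hs : s.Countable)
    (h : ∀ α ∈ s, α < ω₁) : ∃ β < ω₁, ∀ α ∈ s, α < β := by
  have : Countable s := hs
  refine ⟨Order.succ (⨆ i : s, i.1),
    isSuccLimit_omega_one.succ_lt (Ordinal.iSup_lt_omega_one fun i => h i.1 i.2), ?_⟩
  exact fun α hα => Order.lt_succ_iff.2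
    (le_ciSup (f := fun i : s => i.1) Ordinal.bddAbove_of_small ⟨α, hα⟩)

/-! ### Weight -/

theorem exists_basis_mk_eq_weight (X : Type u) [TopologicalSpace X] :
    ∃ B : Set (Set X), TopologicalSpace.IsTopologicalBasis B ∧ Cardinal.mk B = weight X :=
  csInf_mem (s := {c | ∃ B : Set (Set X), TopologicalSpace.IsTopologicalBasis B ∧
    Cardinal.mk B = c}) ⟨_, _, TopologicalSpace.isTopologicalBasis_opens, rfl⟩

theorem weight_le_of_basis {X : Type u} [TopologicalSpace X] {B : Set (Set X)}
    (hB : TopologicalSpace.IsTopologicalBasis B) : weight X ≤ Cardinal.mk B :=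
  csInf_le' ⟨B, hB, rfl⟩

/-- A space that embeds in `ℝ^Γ` with `Γ` infinite has weight at most `|Γ|`: the finite
intersections of preimages of members of a countable base of `ℝ` under the coordinates form a
base. -/
theorem weight_le_of_isInducing {X Γ : Type u} [TopologicalSpace X] [Infinite Γ]
    {φ : X → Γ → ℝ} (hφ : Topology.IsInducing φ) : weight X ≤ Cardinal.mk Γ := by
  obtain ⟨b, hbc, -, hb⟩ := TopologicalSpace.exists_countable_basis ℝ
  let g : Finset (Γ × b) → Set X := fun F => ⋂ i ∈ F, {x | φ x i.1 ∈ i.2.1}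
  have hbasis : TopologicalSpace.IsTopologicalBasis (Set.range g) := by
    refine TopologicalSpace.isTopologicalBasis_of_isOpen_of_nhds ?_ ?_
    · rintro _ ⟨F, rfl⟩
      refine isOpen_biInter_finset fun i _ => ?_
      exact (hb.isOpen i.2.2).preimage ((continuous_apply i.1).comp hφ.continuous)
    · intro x U hx hU
      obtain ⟨V, hV, rfl⟩ := hφ.isOpen_iff.1 hU
      obtain ⟨I, u, hu, hsub⟩ := isOpen_pi_iff.1 hV (φ x) hx
      have hch : ∀ i : Γ, ∃ v : b, i ∈ I → φ x i ∈ v.1 ∧ v.1 ⊆ u i := by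
        intro i
        by_cases hi : i ∈ I
        · obtain ⟨v, hv, hxv, hvu⟩ := hb.exists_subset_of_mem_open (hu i hi).2 (hu i hi).1
          exact ⟨⟨v, hv⟩, fun _ => ⟨hxv, hvu⟩⟩
        · obtain ⟨v, hv, -, -⟩ :=
            hb.exists_subset_of_mem_open (Set.mem_univ (0 : ℝ)) isOpen_univ
          exact ⟨⟨v, hv⟩, fun h => absurd h hi⟩
      choose v hv using hch
      classical
      refine ⟨g (I.image fun i => (i, v i)), ⟨_, rfl⟩, ?_, ?_⟩
      · simp only [g, Set.mem_iInter, Finset.mem_image]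
        rintro _ ⟨i, hi, rfl⟩
        exact (hv i hi).1
      · intro y hy
        refine hsub fun i hi => (hv i hi).2 ?_
        simp only [g, Set.mem_iInter, Finset.mem_image] at hy
        exact hy (i, v i) ⟨i, hi, rfl⟩
  have : Countable b := hbc
  have : Nonempty b := by
    obtain ⟨v, hv, -, -⟩ := hb.exists_subset_of_mem_open (Set.mem_univ (0 : ℝ)) isOpen_univ
    exact ⟨⟨v, hv⟩⟩
  calc weight X ≤ Cardinal.mk (Set.range g) := weight_le_of_basis hbasis
    _ ≤ Cardinal.mk (Finset (Γ × b)) := Cardinal.mk_range_le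
    _ = Cardinal.mk (Γ × b) := Cardinal.mk_finset_of_infinite _
    _ ≤ Cardinal.mk Γ := by
      rw [Cardinal.mk_prod, Cardinal.lift_uzero]
      exact Cardinal.mul_le_of_le (Cardinal.aleph0_le_mk Γ) le_rfl
        ((Cardinal.lift_le_aleph0.2 Cardinal.mk_le_aleph0).trans (Cardinal.aleph0_le_mk Γ))

namespace GradedTree

variable {T : Type u} [PartialOrder T] (G : GradedTree T)

/-! ### Levels of a graded tree -/

theorem grade_injOn {A : Set T} (hA : IsPath A) : Set.InjOn G.grade A := by
  intro s hs t ht h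
  by_contra hne
  rcases hA.1 hs ht hne with hle | hle
  · exact absurd h (G.grade_lt _ _ (lt_of_le_of_ne hle hne)).ne
  · exact absurd h (G.grade_lt _ _ (lt_of_le_of_ne hle (Ne.symm hne))).ne'

theorem restrict_restrict (α β : Ordinal.{u}) (A : PathSpace T) :
    G.restrict α (G.restrict β A) = G.restrict (min α β) A := by
  refine Subtype.ext (Set.ext fun t => ?_)
  simp only [restrict, level, Set.mem_inter_iff, Set.mem_ofPred_eq, le_min_iff]
  tauto

theorem restrict_eq_iff {α : Ordinal.{u}} {A B : PathSpace T} :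
    G.restrict α A = G.restrict α B ↔ ∀ t, G.grade t ≤ α → (t ∈ A.1 ↔ t ∈ B.1) := by
  constructor
  · intro h t ht
    have : t ∈ (G.restrict α A).1 ↔ t ∈ (G.restrict α B).1 := by rw [h]
    exact ⟨fun hA => (this.1 ⟨hA, ht⟩).1, fun hB => (this.2 ⟨hB, ht⟩).1⟩
  · intro h
    exact Subtype.ext (Set.ext fun t => and_congr_left fun ht => h t ht)

theorem restrict_mem_levelPaths (α : Ordinal.{u}) (A : PathSpace T) :
    G.restrict α A ∈ G.levelPaths α := Set.inter_subset_right

theorem restrict_eq_self {α : Ordinal.{u}} {A : PathSpace T} (h : A ∈ G.levelPaths α) :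
    G.restrict α A = A := Subtype.ext (Set.inter_eq_left.2 h)

variable {G}

theorem countable_of_mem_levelPaths {α : Ordinal.{u}} (hα : α < ω₁) {A : PathSpace T}
    (h : A ∈ G.levelPaths α) : A.1.Countable := by
  refine Set.countable_of_injective_of_countable_image (G.grade_injOn A.2.2)
    ((countable_Iio_of_lt_omega_one (isSuccLimit_omega_one.succ_lt hα)).mono ?_)
  rintro _ ⟨t, ht, rfl⟩
  exact Order.lt_succ_iff.2 (show G.grade t ≤ α from h ht)

theorem iUnion_levelPaths (hG : G.IsGradedBelow ω₁) :
    (⋃ α < ω₁, G.levelPaths α) = {A : PathSpace T | A.1.Countable} := by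
  ext A
  simp only [Set.mem_iUnion, Set.mem_ofPred_eq]
  constructor
  · rintro ⟨α, hα, h⟩
    exact countable_of_mem_levelPaths hα h
  · intro h
    obtain ⟨β, hβ, hlt⟩ := exists_lt_omega_one_of_countable (h.image G.grade)
      (by rintro _ ⟨t, -, rfl⟩; exact hG t)
    exact ⟨β, hβ, fun t ht => (hlt _ ⟨t, ht, rfl⟩).le⟩

/-! ### Path spaces with a compatible topology -/

/-- If an open set contains `A` but none of its restrictions `ρ_α A`, then by compactness its
complement contains a point `B` with `ρ_α B = ρ_α A` for all `α < ω₁`; as all grades are below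
`ω₁`, this forces `B = A`. -/
theorem dense_countable (hG : G.IsGradedBelow ω₁) {τ : TopologicalSpace (PathSpace T)}
    (hτ : G.IsCompatible τ) : Dense {A : PathSpace T | A.1.Countable} := by
  obtain ⟨hc, ht2, hcont⟩ := hτ
  intro A
  rw [mem_closure_iff]
  intro U hU hAU
  by_contra hne
  have hout : ∀ α < ω₁, G.restrict α A ∉ U := fun α hα h =>
    hne ⟨_, h, countable_of_mem_levelPaths hα (G.restrict_mem_levelPaths α A)⟩
  let E : Set.Iio (ω₁ : Ordinal.{u}) → Set (PathSpace T) := fun α =>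
    Uᶜ ∩ {B | G.restrict α.1 B = G.restrict α.1 A}
  have hE : ∀ α, IsClosed (E α) := fun α =>
    hU.isClosed_compl.inter (isClosed_eq (hcont α.1) continuous_const)
  have hmono : ∀ α β, α ≤ β → E β ⊆ E α := by
    rintro α β hαβ B ⟨hB, hBA⟩
    refine ⟨hB, ?_⟩
    have := congrArg (G.restrict α.1) hBA
    rwa [restrict_restrict, restrict_restrict, min_eq_left (show α.1 ≤ β.1 from hαβ)] at this
  have : Nonempty (Set.Iio (ω₁ : Ordinal.{u})) := ⟨⟨0, isSuccLimit_omega_one.bot_lt⟩⟩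
  obtain ⟨B, hB⟩ := IsCompact.nonempty_iInter_of_directed_nonempty_isCompact_isClosed E
    (fun α β => ⟨max α β, hmono _ _ (le_max_left _ _), hmono _ _ (le_max_right _ _)⟩)
    (fun α => ⟨G.restrict α.1 A, hout α.1 α.2, by
      simp only [Set.mem_ofPred_eq, restrict_restrict, min_self]⟩)
    (fun α => (hE α).isCompact) hE
  rw [Set.mem_iInter] at hB
  have hBA : B = A := by
    refine Subtype.ext (Set.ext fun t => ?_)
    exact G.restrict_eq_iff.1 (hB ⟨G.grade t, hG t⟩).2 t le_rfl
  exact (hB ⟨0, isSuccLimit_omega_one.bot_lt⟩).1 (hBA ▸ hAU)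

/-- Countably many continuous functions that factor through `ρ_α` and separate the points of the
metrizable compact space `P*(T_α)`. -/
theorem exists_separating_seq {τ : TopologicalSpace (PathSpace T)} (hτ : G.IsCompatible τ)
    {α : Ordinal.{u}} (hm : TopologicalSpace.MetrizableSpace (G.levelPaths α)) :
    ∃ F : ℕ → PathSpace T → ℝ, (∀ n, Continuous (F n)) ∧
      ∀ A B, (∀ n, F n A = F n B) ↔ G.restrict α A = G.restrict α B := by
  obtain ⟨hc, ht2, hcont⟩ := hτ
  have hclosed : IsClosed (G.levelPaths α) := by
    have : G.levelPaths α = {A | G.restrict α A = A} :=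
      Set.ext fun A => ⟨G.restrict_eq_self, fun h => by
        rw [← (show G.restrict α A = A from h)]; exact G.restrict_mem_levelPaths α A⟩
    rw [this]
    exact isClosed_eq (hcont α) continuous_id
  have : CompactSpace (G.levelPaths α) := isCompact_iff_compactSpace.1 hclosed.isCompact
  let _ := TopologicalSpace.metrizableSpaceMetric (G.levelPaths α)
  obtain ⟨f, hf⟩ := TopologicalSpace.exists_embedding_l_infty (G.levelPaths α)
  let p : PathSpace T → G.levelPaths α := fun A => ⟨G.restrict α A, G.restrict_mem_levelPaths α A⟩
  have hp : Continuous p := (hcont α).subtype_mk _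
  refine ⟨fun n A => f (p A) n, fun n => ?_, fun A B => ?_⟩
  · exact (continuous_eval_const n).comp (hf.continuous.comp hp)
  · have hiff : G.restrict α A = G.restrict α B ↔ p A = p B :=
      ⟨fun h => Subtype.ext h, fun h => congrArg Subtype.val h⟩
    rw [hiff, ← hf.injective.eq_iff, DFunLike.ext_iff]

/-- The coordinates of the injection into `ℝ^Γ`: a separating sequence for `P*(T_0)`, and for each
`β < ω₁` the increments of a separating sequence for `P*(T_{β+1})` between `ρ_β` and `ρ_{β+1}`.
The increments of `A` at `β` vanish precisely when `A` has no element of grade `β + 1`. -/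
theorem exists_sigma_injection (hG : G.IsGradedBelow ω₁) {τ : TopologicalSpace (PathSpace T)}
    (hτ : G.IsCompatible τ)
    (hm : ∀ α < ω₁, TopologicalSpace.MetrizableSpace (G.levelPaths α)) :
    ∃ φ : PathSpace T → (Option (ω₁ : Ordinal.{u}).ToType × ℕ → ℝ),
      Continuous φ ∧ Function.Injective φ ∧
        {A : PathSpace T | A.1.Countable} = φ ⁻¹' sigmaProduct _ := by
  have hlt : ∀ i : (ω₁ : Ordinal.{u}).ToType, Order.succ i.toOrd.1 < ω₁ := fun i =>
    isSuccLimit_omega_one.succ_lt i.toOrd.2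
  obtain ⟨F₀, hF₀c, hF₀⟩ := exists_separating_seq hτ (hm 0 isSuccLimit_omega_one.bot_lt)
  choose F hFc hF using fun i : (ω₁ : Ordinal.{u}).ToType => exists_separating_seq hτ (hm _ (hlt i))
  let φ : PathSpace T → (Option (ω₁ : Ordinal.{u}).ToType × ℕ → ℝ) := fun A p =>
    p.1.elim (F₀ p.2 A) fun i => F i p.2 A - F i p.2 (G.restrict i.toOrd.1 A)
  have hzero : ∀ A i, (∀ n, φ A (some i, n) = 0) ↔ ∀ t ∈ A.1, G.grade t ≠ Order.succ i.toOrd.1 := by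
    intro A i
    have : (∀ n, φ A (some i, n) = 0) ↔ ∀ n, F i n A = F i n (G.restrict i.toOrd.1 A) :=
      forall_congr' fun n => sub_eq_zero
    rw [this, hF, restrict_eq_iff]
    simp only [restrict, level, Set.mem_inter_iff, Set.mem_ofPred_eq]
    constructor
    · intro h t ht hgt
      have := ((h t hgt.le).1 ht).2
      rw [hgt] at this
      exact absurd this (not_le.2 (Order.lt_succ _))
    · refine fun h t hle => ⟨fun ht => ⟨ht, ?_⟩, fun ht => ht.1⟩
      exact Order.lt_succ_iff.1 (lt_of_le_of_ne hle (h t ht))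
  refine ⟨φ, ?_, ?_, ?_⟩
  · refine continuous_pi ?_
    rintro ⟨_ | i, n⟩
    · exact hF₀c n
    · exact (hFc i n).sub ((hFc i n).comp (hτ.2.2 _))
  · intro A B hAB
    have key : ∀ α < ω₁, ∀ t, G.grade t = α → (t ∈ A.1 ↔ t ∈ B.1) := by
      intro α
      induction α using WellFoundedLT.induction with
      | ind α ih =>
        intro hα t ht
        rcases G.grade_zero_or_succ t with h0 | ⟨β, hβ⟩
        · refine G.restrict_eq_iff.1 ((hF₀ A B).1 fun n => ?_) t h0.le
          exact congrFun hAB (none, n)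
        · have hβα : β < α := by rw [← ht, hβ]; exact Order.lt_succ β
          let i : (ω₁ : Ordinal.{u}).ToType := Ordinal.ToType.mk ⟨β, hβα.trans hα⟩
          have hi : i.toOrd.1 = β := by simp [i, Ordinal.ToType.toOrd]
          have hres : G.restrict i.toOrd.1 A = G.restrict i.toOrd.1 B := by
            rw [hi]
            refine G.restrict_eq_iff.2 fun s hs => ?_
            exact ih _ (hs.trans_lt hβα) (hG s) s rfl
          refine G.restrict_eq_iff.1 ((hF i A B).1 fun n => ?_) t (by rw [hi, hβ])
          have h : F i n A - F i n (G.restrict i.toOrd.1 A) =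
              F i n B - F i n (G.restrict i.toOrd.1 B) := congrFun hAB (some i, n)
          rw [hres] at h
          exact sub_left_injective h
    exact Subtype.ext (Set.ext fun t => key _ (hG t) t rfl)
  · ext A
    simp only [Set.mem_ofPred_eq, Set.mem_preimage, sigmaProduct]
    constructor
    · intro hA
      have hD : {i : (ω₁ : Ordinal.{u}).ToType |
          ∃ t ∈ A.1, G.grade t = Order.succ i.toOrd.1}.Countable := by
        refine Set.countable_of_injective_of_countable_image
          (f := fun i => Order.succ i.toOrd.1) ?_ ((hA.image G.grade).mono ?_)
        · intro i _ j _ hij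
          exact Ordinal.ToType.mk.symm.injective (Subtype.ext (Order.succ_injective hij))
        · rintro _ ⟨i, ⟨t, ht, hti⟩, rfl⟩
          exact ⟨t, ht, hti⟩
      refine (((hD.image some).insert none).prod (Set.countable_univ (α := ℕ))).mono ?_
      rintro ⟨_ | i, n⟩ hne
      · exact ⟨Set.mem_insert _ _, trivial⟩
      · refine ⟨Set.mem_insert_of_mem _ ⟨i, ?_, rfl⟩, trivial⟩
        by_contra hcon
        refine hne ((hzero A i).2 (fun t ht hti => hcon ⟨t, ht, hti⟩) n)
    · intro hA
      refine Set.countable_of_injective_of_countable_image (G.grade_injOn A.2.2) ?_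
      refine ((hA.image fun p => p.1.elim 0 fun i => Order.succ i.toOrd.1).insert 0).mono ?_
      rintro _ ⟨t, ht, rfl⟩
      rcases G.grade_zero_or_succ t with h0 | ⟨β, hβ⟩
      · exact Or.inl h0
      · right
        let i : (ω₁ : Ordinal.{u}).ToType :=
          Ordinal.ToType.mk ⟨β, (Order.lt_succ β).trans (hβ ▸ hG t)⟩
        have hi : i.toOrd.1 = β := by simp [i, Ordinal.ToType.toOrd]
        have hne : ¬ ∀ n, φ A (some i, n) = 0 := fun h =>
          (hzero A i).1 h t ht (by rw [hi, hβ])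
        obtain ⟨n, hn⟩ := not_forall.1 hne
        refine ⟨(some i, n), hn, ?_⟩
        change Order.succ i.toOrd.1 = _
        rw [hi, hβ]

end GradedTree

theorem mk_option_omega_one_prod :
    Cardinal.mk (Option (ω₁ : Ordinal.{u}).ToType × ℕ) ≤ ℵ₁ := by
  rw [Cardinal.mk_prod, Cardinal.mk_option, Cardinal.mk_toType, Ordinal.card_omega,
    Cardinal.lift_uzero, Cardinal.mk_nat, Cardinal.lift_aleph0]
  refine Cardinal.mul_le_of_le (Cardinal.aleph0_le_aleph 1) ?_ (Cardinal.aleph0_le_aleph 1)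
  exact Cardinal.add_le_of_le (Cardinal.aleph0_le_aleph 1) le_rfl
    (Cardinal.one_le_aleph0.trans (Cardinal.aleph0_le_aleph 1))

/-! ### Continuous commuting systems of retractions and their trees -/

/-- A system of commuting retractions `r_α` of `K` with increasing images, continuous at limit
ordinals and with `r_{ω₁} = id`. All ordinals are admitted as indices, so that no bound on them has
to be carried along; the axioms force `r_α = id` for `α ≥ ω₁`. -/
structure RetractionSystem (K : Type u) [TopologicalSpace K] where
  retr : Ordinal.{u} → K → K
  continuous_retr : ∀ α, Continuous (retr α)
  retr_retr : ∀ α β x, retr α (retr β x) = retr (min α β) x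
  retr_limit : ∀ α, Order.IsSuccLimit α → ∀ x y, (∀ β < α, retr β x = retr β y) →
    retr α x = retr α y
  retr_omega_one : ∀ x, retr ω₁ x = x

namespace RetractionSystem

variable {K : Type u} [TopologicalSpace K] (R : RetractionSystem K)

/-- The rank of a point: the least `α` for which it is fixed by `r_α`. -/
noncomputable def rank (x : K) : Ordinal.{u} := sInf {α | R.retr α x = x}

theorem retr_rank (x : K) : R.retr (R.rank x) x = x :=
  csInf_mem (s := {α | R.retr α x = x}) ⟨ω₁, R.retr_omega_one x⟩

theorem rank_le_iff {x : K} {α : Ordinal.{u}} : R.rank x ≤ α ↔ R.retr α x = x := by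
  constructor
  · intro h
    calc R.retr α x = R.retr α (R.retr (R.rank x) x) := by rw [R.retr_rank]
      _ = x := by rw [R.retr_retr, min_eq_right h, R.retr_rank]
  · exact fun h => csInf_le' h

theorem rank_retr_le (α : Ordinal.{u}) (x : K) : R.rank (R.retr α x) ≤ α := by
  rw [rank_le_iff, R.retr_retr, min_self]

/-- The tree of a retraction system: the points whose rank is zero or a countable successor. -/
def Node : Type u := {x : K // R.rank x < ω₁ ∧ (R.rank x = 0 ∨ ∃ β, R.rank x = Order.succ β)}

variable {R}

theorem rank_le_of_retr_eq {s t : K} (h : R.retr (R.rank s) t = s) : R.rank s ≤ R.rank t := by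
  rw [rank_le_iff]
  calc R.retr (R.rank t) s = R.retr (R.rank t) (R.retr (R.rank s) t) := by rw [h]
    _ = R.retr (R.rank s) (R.retr (R.rank t) t) := by rw [R.retr_retr, R.retr_retr, min_comm]
    _ = s := by rw [R.retr_rank, h]

variable (R)

/-- `s ≤ t` if `s` is the image of `t` under the retraction indexed by the rank of `s`. -/
instance : PartialOrder R.Node where
  le s t := R.retr (R.rank s.1) t.1 = s.1
  le_refl s := R.retr_rank s.1
  le_trans s t w hst htw := by
    have h : R.retr (min (R.rank s.1) (R.rank t.1)) w.1 = s.1 := by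
      rw [← R.retr_retr, htw, hst]
    rwa [min_eq_left (rank_le_of_retr_eq hst)] at h
  le_antisymm s t hst hts := by
    have h := le_antisymm (rank_le_of_retr_eq hst) (rank_le_of_retr_eq hts)
    refine Subtype.ext (Eq.trans hst.symm ?_)
    rw [h, R.retr_rank]

variable {R}

theorem Node.le_iff {s t : R.Node} : s ≤ t ↔ R.retr (R.rank s.1) t.1 = s.1 := Iff.rfl

theorem Node.rank_lt {s t : R.Node} (h : s < t) : R.rank s.1 < R.rank t.1 := by
  refine lt_of_le_of_ne (rank_le_of_retr_eq h.le) fun heq => h.ne ?_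
  have := Node.le_iff.1 h.le
  rw [heq, R.retr_rank] at this
  exact Subtype.ext this.symm

/-- Two nodes lying on the path of a common point are comparable. -/
theorem Node.le_of_rank_le {s t : R.Node} {x : K} (hs : R.retr (R.rank s.1) x = s.1)
    (ht : R.retr (R.rank t.1) x = t.1) (h : R.rank s.1 ≤ R.rank t.1) : s ≤ t := by
  rw [Node.le_iff]
  calc R.retr (R.rank s.1) t.1 = R.retr (R.rank s.1) (R.retr (R.rank t.1) x) := by rw [ht]
    _ = s.1 := by rw [R.retr_retr, min_eq_left h, hs]

variable (R)

theorem exists_node_rank_zero (x : K) : ∃ s : R.Node, s.1 = R.retr 0 x ∧ R.rank s.1 = 0 := by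
  have h : R.rank (R.retr 0 x) = 0 := le_antisymm (R.rank_retr_le 0 x) bot_le
  exact ⟨⟨R.retr 0 x, by rw [h]; exact isSuccLimit_omega_one.bot_lt, Or.inl h⟩, rfl, h⟩

/-- The nodes graded by their rank. -/
noncomputable def gradedTree : GradedTree R.Node where
  wellOrdered_Iio t :=
    { wf := Subrelation.wf (r := InvImage (· < ·) fun s : Set.Iio t => R.rank s.1.1)
        (fun {a b} (h : a < b) => Node.rank_lt (show a.1 < b.1 from h))
        (InvImage.wf _ Ordinal.lt_wf)
      trichotomous := by
        intro a b hab hba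
        rcases le_total (R.rank a.1.1) (R.rank b.1.1) with h | h
        · exact eq_of_le_of_not_lt
            (show a ≤ b from Node.le_of_rank_le (Node.le_iff.1 a.2.le) (Node.le_iff.1 b.2.le) h) hab
        · exact (eq_of_le_of_not_lt
            (show b ≤ a from Node.le_of_rank_le (Node.le_iff.1 b.2.le) (Node.le_iff.1 a.2.le) h)
            hba).symm }
  grade t := R.rank t.1
  grade_zero_or_succ t := t.2.2
  grade_of_isMin t ht := by
    obtain ⟨s, hs, h0⟩ := R.exists_node_rank_zero t.1
    have hle : s ≤ t := by rw [Node.le_iff, h0, hs]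
    exact le_antisymm ((rank_le_of_retr_eq (ht hle)).trans h0.le) bot_le
  grade_lt _ _ h := Node.rank_lt h

theorem gradedTree_isGradedBelow : R.gradedTree.IsGradedBelow ω₁ := fun t => t.2.1

/-- The path of a point `x`: the nodes of the form `r_α x`. -/
def path (x : K) : PathSpace R.Node :=
  ⟨{t | R.retr (R.rank t.1) x = t.1}, by
    obtain ⟨s, hs, h0⟩ := R.exists_node_rank_zero x
    refine ⟨s, ?_⟩
    change R.retr (R.rank s.1) x = s.1
    rw [h0, hs], by
    intro s hs t ht _
    exact (le_total (R.rank s.1) (R.rank t.1)).imp (Node.le_of_rank_le hs ht)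
      (Node.le_of_rank_le ht hs), by
    intro t ht s hst
    have hlt : s < t := hst
    have ht' : R.retr (R.rank t.1) x = t.1 := ht
    change R.retr (R.rank s.1) x = s.1
    have h := Node.le_iff.1 hlt.le
    rwa [← ht', R.retr_retr, min_eq_left (Node.rank_lt hlt).le] at h⟩

theorem mem_path {x : K} {t : R.Node} : t ∈ (R.path x).1 ↔ R.retr (R.rank t.1) x = t.1 := Iff.rfl

theorem mem_path_retr {x : K} {t : R.Node} {α : Ordinal.{u}} :
    t ∈ (R.path (R.retr α x)).1 ↔ t ∈ (R.path x).1 ∧ R.rank t.1 ≤ α := by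
  rw [mem_path, mem_path, R.retr_retr]
  constructor
  · intro h
    have hle : R.rank t.1 ≤ α := by
      refine le_trans ?_ (R.rank_retr_le α x)
      refine rank_le_of_retr_eq ?_
      rw [R.retr_retr, h]
    rw [min_eq_left hle] at h
    exact ⟨h, hle⟩
  · rintro ⟨h, hle⟩
    rwa [min_eq_left hle]

theorem restrict_path (α : Ordinal.{u}) (x : K) :
    R.gradedTree.restrict α (R.path x) = R.path (R.retr α x) :=
  Subtype.ext (Set.ext fun _ => (R.mem_path_retr).symm)

/-- At the least `α` with `r_α x ≠ r_α y`, which is not a limit, at least one of `r_α x` and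
`r_α y` has rank exactly `α` and so is a node that lies on one of the two paths only. -/
theorem path_injective : Function.Injective R.path := by
  intro x y hxy
  have key : ∀ α ≤ ω₁, R.retr α x = R.retr α y := by
    intro α
    induction α using WellFoundedLT.induction with
    | ind α ih =>
      intro hα
      rcases Ordinal.zero_or_succ_or_isSuccLimit α with rfl | ⟨β, rfl⟩ | hlim
      · obtain ⟨s, hs, h0⟩ := R.exists_node_rank_zero x
        have hsx : s ∈ (R.path x).1 := by rw [mem_path, h0, hs]
        rw [hxy, mem_path, h0, hs] at hsx
        exact hsx.symm
      · have hlt : Order.succ β < ω₁ := lt_of_le_of_ne hα fun h =>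
          isSuccLimit_omega_one.succ_lt (lt_of_lt_of_le (Order.lt_succ β) hα) |>.ne h
        have hβ := ih β (Order.lt_succ β) ((Order.le_succ β).trans hα)
        -- A point `r_{β+1} a` that differs from `r_β a` is a node of rank `β + 1`.
        have step : ∀ a b : K, R.path a = R.path b → R.retr (Order.succ β) a ≠ R.retr β a →
            R.retr (Order.succ β) a = R.retr (Order.succ β) b := by
          intro a b hab hne
          have hrank : R.rank (R.retr (Order.succ β) a) = Order.succ β := by
            refine le_antisymm (R.rank_retr_le _ _) (Order.succ_le_of_lt (not_le.1 fun h => hne ?_))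
            rw [rank_le_iff, R.retr_retr, min_eq_left (Order.le_succ β)] at h
            exact h.symm
          let s : R.Node := ⟨R.retr (Order.succ β) a, by rwa [hrank], Or.inr ⟨β, hrank⟩⟩
          have hs : s ∈ (R.path a).1 := by
            rw [mem_path]
            change R.retr (R.rank (R.retr (Order.succ β) a)) a = R.retr (Order.succ β) a
            rw [hrank]
          rw [hab, mem_path] at hs
          change R.retr (R.rank (R.retr (Order.succ β) a)) b = R.retr (Order.succ β) a at hs
          rw [hrank] at hs
          exact hs.symm
        by_cases hx : R.retr (Order.succ β) x = R.retr β x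
        · by_cases hy : R.retr (Order.succ β) y = R.retr β y
          · rw [hx, hy, hβ]
          · exact (step y x hxy.symm hy).symm
        · exact step x y hxy hx
      · exact R.retr_limit α hlim x y fun β hβ => ih β hβ (hβ.le.trans hα)
  rw [← R.retr_omega_one x, key ω₁ le_rfl, R.retr_omega_one]

/-- By compactness some `x` retracts to every node of a given path `A`; its image under `r_α`, where
`α` is the supremum of the ranks in `A`, has path `A`. Nodes of rank `α` outside `A` do not occur,
because a supremum that is not attained is a limit. -/
theorem path_surjective [CompactSpace K] [T2Space K] : Function.Surjective R.path := by
  intro A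
  have hA := A.2.2
  have : Nonempty A.1 := A.2.1.to_subtype
  let E : A.1 → Set K := fun a => {x | R.retr (R.rank a.1.1) x = a.1.1}
  have hE : ∀ a, IsClosed (E a) := fun a => isClosed_eq (R.continuous_retr _) continuous_const
  have hmono : ∀ a b : A.1, a.1 ≤ b.1 → E b ⊆ E a := by
    intro a b hab x hx
    have hx' : R.retr (R.rank b.1.1) x = b.1.1 := hx
    change R.retr (R.rank a.1.1) x = a.1.1
    have h := Node.le_iff.1 hab
    rwa [← hx', R.retr_retr, min_eq_left (rank_le_of_retr_eq hab)] at h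
  obtain ⟨x, hx⟩ := IsCompact.nonempty_iInter_of_directed_nonempty_isCompact_isClosed E
    (fun a b => by
      rcases hA.1.total a.2 b.2 with h | h
      · exact ⟨b, hmono _ _ h, subset_rfl⟩
      · exact ⟨a, subset_rfl, hmono _ _ h⟩)
    (fun a => ⟨a.1.1, R.retr_rank _⟩) (fun a => (hE a).isCompact) hE
  rw [Set.mem_iInter] at hx
  have hx' : ∀ a ∈ A.1, R.retr (R.rank a.1) x = a.1 := fun a ha => hx ⟨a, ha⟩
  have hle : ∀ a ∈ A.1, R.rank a.1 ≤ ⨆ a : A.1, R.rank a.1.1 := fun a ha =>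
    le_ciSup (f := fun a : A.1 => R.rank a.1.1) Ordinal.bddAbove_of_small ⟨a, ha⟩
  refine ⟨R.retr (⨆ a : A.1, R.rank a.1.1) x, Subtype.ext (Set.ext fun t => ?_)⟩
  rw [R.mem_path_retr]
  constructor
  · rintro ⟨ht, htle⟩
    by_cases hlt : ∃ a ∈ A.1, R.rank t.1 ≤ R.rank a.1
    · obtain ⟨a, ha, hta⟩ := hlt
      have hta' : t ≤ a := Node.le_of_rank_le ht (hx' a ha) hta
      rcases hta'.eq_or_lt with rfl | h
      · exact ha
      · exact hA.2 a ha h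
    · push Not at hlt
      rcases t.2.2 with h0 | ⟨β, hβ⟩
      · obtain ⟨a, ha⟩ := A.2.1
        exact absurd (hlt a ha) (by rw [h0]; exact not_lt_bot)
      · have : (⨆ a : A.1, R.rank a.1.1) ≤ β := ciSup_le fun a =>
          Order.lt_succ_iff.1 (hβ ▸ hlt a.1 a.2)
        rw [hβ] at htle
        exact absurd (htle.trans this) (not_le.2 (Order.lt_succ β))
  · exact fun ht => ⟨hx' t ht, hle t ht⟩

/-- A compact space with a retraction system is homeomorphic to the path space of the associated
tree, in such a way that the images of the retractions correspond to the levels. -/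
theorem exists_homeomorph [CompactSpace K] [T2Space K] :
    ∃ (τ : TopologicalSpace (PathSpace R.Node)) (f : K ≃ₜ PathSpace R.Node),
      R.gradedTree.IsCompatible τ ∧
        ∀ α, f '' Set.range (R.retr α) = R.gradedTree.levelPaths α := by
  let e : K ≃ PathSpace R.Node := Equiv.ofBijective R.path ⟨R.path_injective, R.path_surjective⟩
  let τ : TopologicalSpace (PathSpace R.Node) := TopologicalSpace.induced e.symm inferInstance
  let f : K ≃ₜ PathSpace R.Node := (e.symm.toHomeomorphOfIsInducing ⟨rfl⟩).symm
  have hres : ∀ α, R.gradedTree.restrict α = f ∘ R.retr α ∘ f.symm := by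
    intro α
    funext A
    obtain ⟨x, rfl⟩ := f.surjective A
    simp only [Function.comp_apply, Homeomorph.symm_apply_apply]
    exact R.restrict_path α x
  refine ⟨τ, f, ⟨f.compactSpace, f.t2Space, fun α => ?_⟩, fun α => ?_⟩
  · rw [hres]
    exact f.continuous.comp ((R.continuous_retr α).comp f.symm.continuous)
  · ext A
    constructor
    · rintro ⟨_, ⟨x, rfl⟩, rfl⟩
      have h : f (R.retr α x) = R.gradedTree.restrict α (f x) := (R.restrict_path α x).symm
      rw [h]
      exact R.gradedTree.restrict_mem_levelPaths α _
    · intro hA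
      refine ⟨R.retr α (f.symm A), ⟨_, rfl⟩, ?_⟩
      rw [← R.gradedTree.restrict_eq_self hA, hres]
      simp [R.retr_retr]

end RetractionSystem

/-! ### Closed sets of coordinates -/

section Hull

variable {Γ : Type u} (c : Finset Γ → Set Γ)

/-- `M` is closed under the set-valued operation `c` on finite sets. -/
def IsClosedUnder (M : Set Γ) : Prop := ∀ F : Finset Γ, ↑F ⊆ M → c F ⊆ M

/-- The least set containing `X` that is closed under `c`. -/
def hull (X : Set Γ) : Set Γ := ⋂₀ {M | X ⊆ M ∧ IsClosedUnder c M}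

theorem subset_hull (X : Set Γ) : X ⊆ hull c X := Set.subset_sInter fun _ hM => hM.1

variable {c}

theorem hull_subset {X M : Set Γ} (h : X ⊆ M) (hM : IsClosedUnder c M) : hull c X ⊆ M :=
  Set.sInter_subset_of_mem ⟨h, hM⟩

variable (c) in
theorem isClosedUnder_hull (X : Set Γ) : IsClosedUnder c (hull c X) := fun F hF =>
  Set.subset_sInter fun _ hM => hM.2 F (hF.trans (hull_subset hM.1 hM.2))

theorem hull_mono {X Y : Set Γ} (h : X ⊆ Y) : hull c X ⊆ hull c Y :=
  hull_subset (h.trans (subset_hull c Y)) (isClosedUnder_hull c Y)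

theorem isClosedUnder_iUnion {ι : Type*} [Nonempty ι] {M : ι → Set Γ}
    (hd : Directed (· ⊆ ·) M) (hM : ∀ i, IsClosedUnder c (M i)) :
    IsClosedUnder c (⋃ i, M i) := by
  intro F hF
  obtain ⟨i, hi⟩ := hd.exists_mem_subset_of_finset_subset_biUnion hF
  exact (hM i F hi).trans (Set.subset_iUnion M i)

/-- The hull of a countable set is exhausted by countably many applications of `c` to the countably
many finite subsets of a countable set. -/
theorem countable_hull (hc : ∀ F, (c F).Countable) {X : Set Γ} (hX : X.Countable) :
    (hull c X).Countable := by
  let step : Set Γ → Set Γ := fun M => M ∪ ⋃ F ∈ {F : Finset Γ | ↑F ⊆ M}, c F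
  let N : ℕ → Set Γ := fun n => step^[n] X
  have hsucc : ∀ n, N (n + 1) = step (N n) := fun n => Function.iterate_succ_apply' step n X
  have hcount : ∀ n, (N n).Countable := by
    intro n
    induction n with
    | zero => exact hX
    | succ n ih =>
      rw [hsucc]
      refine ih.union (Set.Countable.biUnion ?_ fun F _ => hc F)
      refine Set.countable_of_injective_of_countable_image (f := fun F : Finset Γ => (F : Set Γ))
        Finset.coe_injective.injOn ((Set.countable_ofPred_finite_subset ih).mono ?_)
      rintro _ ⟨F, hF, rfl⟩
      exact ⟨F.finite_toSet, hF⟩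
  have hmono : Monotone N := monotone_nat_of_le_succ fun n => by
    rw [hsucc]; exact Set.subset_union_left
  refine (Set.countable_iUnion hcount).mono (hull_subset (Set.subset_iUnion N 0) ?_)
  intro F hF
  obtain ⟨n, hn⟩ :=
    (hmono.directed_le : Directed (· ⊆ ·) N).exists_mem_subset_of_finset_subset_biUnion hF
  refine Set.Subset.trans ?_ (Set.subset_iUnion N (n + 1))
  rw [hsucc]
  exact Set.Subset.trans (Set.subset_biUnion_of_mem (u := c) hn) Set.subset_union_right

end Hull

/-! ### Retractions of a Valdivia compactum -/

section Retractions

variable {K : Type u} [TopologicalSpace K] {Γ : Type u} {φ : K → Γ → ℝ}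

/-- For each finite set `F` of coordinates choose a countable set of points of the `Σ`-subset whose
projections to `ℝ^F` are dense in the projection of `K`; `c F` is the union of their supports. If `M`
is closed under `c`, then the points with support in `M` approximate every `x` in finitely many
coordinates of `M`, so by compactness `φ x`, replaced by `0` off `M`, lies in the range of `φ`. -/
theorem exists_support_operation [CompactSpace K] (hφ : Continuous φ)
    (hS : Dense (φ ⁻¹' sigmaProduct Γ)) :
    ∃ c : Finset Γ → Set Γ, (∀ F, (c F).Countable) ∧
      ∀ M, IsClosedUnder c M → ∀ x, ∃ y, φ y = M.indicator (φ x) := by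
  classical
  have hD : ∀ F : Finset Γ, ∃ D : Set K, D ⊆ φ ⁻¹' sigmaProduct Γ ∧ D.Countable ∧
      ∀ x, (fun i : F => φ x i) ∈ closure ((fun d => fun i : F => φ d i) '' D) := by
    intro F
    let π : K → F → ℝ := fun x i => φ x i
    have hπ : Continuous π := continuous_pi fun i => (continuous_apply i.1).comp hφ
    obtain ⟨t, ht, htc, hts⟩ := (TopologicalSpace.IsSeparable.of_separableSpace
      (π '' (φ ⁻¹' sigmaProduct Γ))).exists_countable_dense_subset
    have hch : ∀ p : t, ∃ d ∈ φ ⁻¹' sigmaProduct Γ, π d = p.1 := fun p => ht p.2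
    choose d hdS hd using hch
    have : Countable t := htc
    refine ⟨Set.range d, Set.range_subset_iff.2 hdS, Set.countable_range d, fun x => ?_⟩
    have himg : π '' Set.range d = t := by
      ext p
      constructor
      · rintro ⟨_, ⟨q, rfl⟩, rfl⟩
        rw [hd]
        exact q.2
      · exact fun hp => ⟨d ⟨p, hp⟩, ⟨_, rfl⟩, hd _⟩
    change π x ∈ closure (π '' Set.range d)
    rw [himg]
    exact closure_minimal hts isClosed_closure
      (image_closure_subset_closure_image hπ ⟨x, hS x, rfl⟩)
  choose D hDS hDc hDx using hD
  refine ⟨fun F => ⋃ d ∈ D F, {γ | φ d γ ≠ 0}, fun F => (hDc F).biUnion fun d hd => hDS F hd, ?_⟩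
  intro M hM x
  have hclosed : IsClosed (Set.range φ) := (isCompact_range hφ).isClosed
  suffices h : M.indicator (φ x) ∈ closure (Set.range φ) by rwa [hclosed.closure_eq] at h
  rw [mem_closure_iff]
  intro U hU hxU
  obtain ⟨I, u, hu, hsub⟩ := isOpen_pi_iff.1 hU _ hxU
  let F : Finset Γ := I.filter (· ∈ M)
  have hFM : (F : Set Γ) ⊆ M := fun i hi => (Finset.mem_filter.1 hi).2
  have hopen : IsOpen (Set.univ.pi fun i : F => u i) :=
    isOpen_set_pi Set.finite_univ fun i _ => (hu i (Finset.mem_filter.1 i.2).1).1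
  obtain ⟨_, hdu, d, hdD, rfl⟩ := mem_closure_iff.1 (hDx F x) _ hopen (by
    intro i _
    have := (hu i (Finset.mem_filter.1 i.2).1).2
    rwa [Set.indicator_of_mem (hFM i.2)] at this)
  refine ⟨φ d, hsub fun i hi => ?_, d, rfl⟩
  by_cases hiM : i ∈ M
  · exact hdu ⟨i, Finset.mem_filter.2 ⟨hi, hiM⟩⟩ trivial
  · have h0 : φ d i = 0 := by
      by_contra hne
      exact hiM (hM F hFM (Set.mem_biUnion hdD hne))
    have := (hu i hi).2
    rw [Set.indicator_of_notMem hiM] at this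
    rwa [h0]

/-- Enumerate the coordinates by countable ordinals; `r_α` is the retraction given by the hull of the
coordinates with index less than `α`. -/
theorem exists_retractionSystem_of_enumeration [CompactSpace K] [T2Space K] (hφ : Continuous φ)
    (hinj : Function.Injective φ) (hS : Dense (φ ⁻¹' sigmaProduct Γ)) {e : Γ → Ordinal.{u}}
    (he : Function.Injective e) (he₁ : ∀ γ, e γ < ω₁) :
    ∃ R : RetractionSystem K,
      (∀ α < ω₁, TopologicalSpace.MetrizableSpace (Set.range (R.retr α))) ∧
      (⋃ α < ω₁, Set.range (R.retr α)) = φ ⁻¹' sigmaProduct Γ := by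
  obtain ⟨c, hc, hret⟩ := exists_support_operation hφ hS
  let M : Ordinal.{u} → Set Γ := fun α => hull c {γ | e γ < α}
  have hMmono : Monotone M := fun α β h => hull_mono fun γ hγ => lt_of_lt_of_le hγ h
  have hMclosed : ∀ α, IsClosedUnder c (M α) := fun α => isClosedUnder_hull c _
  have hMtop : ∀ γ, γ ∈ M ω₁ := fun γ => subset_hull c _ (he₁ γ)
  have hMcount : ∀ α < ω₁, (M α).Countable := fun α hα =>
    countable_hull hc (Set.countable_of_injective_of_countable_image he.injOn
      ((countable_Iio_of_lt_omega_one hα).mono (by rintro _ ⟨γ, hγ, rfl⟩; exact hγ)))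
  have hMlim : ∀ α, Order.IsSuccLimit α → ∀ γ ∈ M α, ∃ β < α, γ ∈ M β := by
    intro α hα γ hγ
    have : Nonempty (Set.Iio α) := ⟨⟨0, hα.bot_lt⟩⟩
    have hsub : M α ⊆ ⋃ β : Set.Iio α, M β.1 := by
      refine hull_subset ?_ (isClosedUnder_iUnion ?_ fun β => hMclosed β.1)
      · intro δ hδ
        exact Set.mem_iUnion.2 ⟨⟨Order.succ (e δ), hα.succ_lt hδ⟩,
          subset_hull c _ (Order.lt_succ (e δ))⟩
      · exact Monotone.directed_le (f := fun β : Set.Iio α => M β.1) fun β β' h => hMmono h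
    obtain ⟨β, hβ⟩ := Set.mem_iUnion.1 (hsub hγ)
    exact ⟨β.1, β.2, hβ⟩
  choose r hr using fun α => hret (M α) (hMclosed α)
  have hrmem : ∀ {α γ} (x : K), γ ∈ M α → φ (r α x) γ = φ x γ := fun x h => by
    rw [hr, Set.indicator_of_mem h]
  have hrnot : ∀ {α γ} (x : K), γ ∉ M α → φ (r α x) γ = 0 := fun x h => by
    rw [hr, Set.indicator_of_notMem h]
  have hcont : ∀ α, Continuous (r α) := by
    intro α
    refine (hφ.isClosedEmbedding hinj).isInducing.continuous_iff.2 (continuous_pi fun γ => ?_)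
    by_cases h : γ ∈ M α
    · exact ((continuous_apply γ).comp hφ).congr fun x => (hrmem x h).symm
    · exact continuous_const.congr fun x => (hrnot x h).symm
  let R : RetractionSystem K :=
    { retr := r
      continuous_retr := hcont
      retr_retr := by
        intro α β x
        refine hinj (funext fun γ => ?_)
        by_cases hα : γ ∈ M α
        · by_cases hβ : γ ∈ M β
          · have : γ ∈ M (min α β) := by rcases min_choice α β with h | h <;> rwa [h]
            rw [hrmem _ hα, hrmem _ hβ, hrmem _ this]
          · rw [hrmem _ hα, hrnot _ hβ, hrnot _ fun h => hβ (hMmono (min_le_right α β) h)]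
        · rw [hrnot _ hα, hrnot _ fun h => hα (hMmono (min_le_left α β) h)]
      retr_limit := by
        intro α hα x y h
        refine hinj (funext fun γ => ?_)
        by_cases hγ : γ ∈ M α
        · obtain ⟨β, hβ, hγβ⟩ := hMlim α hα γ hγ
          rw [hrmem x hγ, hrmem y hγ, ← hrmem x hγβ, ← hrmem y hγβ, h β hβ]
        · rw [hrnot x hγ, hrnot y hγ]
      retr_omega_one := fun x => hinj (funext fun γ => hrmem x (hMtop γ)) }
  refine ⟨R, fun α hα => ?_, ?_⟩
  · have : Countable (M α) := hMcount α hα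
    have : CompactSpace (Set.range (R.retr α)) :=
      isCompact_iff_compactSpace.1 (isCompact_range (hcont α))
    let g : Set.range (R.retr α) → M α → ℝ := fun x γ => φ x.1 γ.1
    have hg : Continuous g :=
      continuous_pi fun γ => (continuous_apply γ.1).comp (hφ.comp continuous_subtype_val)
    refine (hg.isClosedEmbedding ?_).isEmbedding.metrizableSpace
    rintro ⟨_, x, rfl⟩ ⟨_, y, rfl⟩ hxy
    refine Subtype.ext (hinj (funext fun γ => ?_))
    by_cases hγ : γ ∈ M α
    · exact congrFun hxy ⟨γ, hγ⟩
    · exact (hrnot x hγ).trans (hrnot y hγ).symm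
  · ext x
    simp only [Set.mem_iUnion]
    constructor
    · rintro ⟨α, hα, y, rfl⟩
      refine (hMcount α hα).mono fun γ hγ => ?_
      by_contra hnot
      exact hγ (hrnot y hnot)
    · intro hx
      obtain ⟨β, hβ, hlt⟩ := exists_lt_omega_one_of_countable (Set.Countable.image hx e)
        (by rintro _ ⟨γ, -, rfl⟩; exact he₁ γ)
      refine ⟨β, hβ, x, hinj (funext fun γ => ?_)⟩
      by_cases hγ : γ ∈ M β
      · exact hrmem x hγ
      · by_contra hne
        change φ (r β x) γ ≠ φ x γ at hne
        rw [hrnot x hγ] at hne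
        exact hγ (subset_hull c _ (hlt _ ⟨γ, hne.symm, rfl⟩))

/-- Every coordinate that does not vanish on `K` is nonzero at a point of the dense `Σ`-subset chosen
from some member of a base, so there are at most `ℵ₁` such coordinates; the others are discarded. -/
theorem exists_retractionSystem [CompactSpace K] [T2Space K] (hw : weight K ≤ ℵ₁) {S : Set K}
    (hd : Dense S) (hS : IsSigmaSubset S) :
    ∃ R : RetractionSystem K,
      (∀ α < ω₁, TopologicalSpace.MetrizableSpace (Set.range (R.retr α))) ∧
      (⋃ α < ω₁, Set.range (R.retr α)) = S := by
  obtain ⟨Γ, φ, hφ, hinj, rfl⟩ := hS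
  obtain ⟨B, hB, hBw⟩ := exists_basis_mk_eq_weight K
  let Δ : Set Γ := {γ | ∃ x, φ x γ ≠ 0}
  let ι : Type u := {b : B // b.1.Nonempty}
  have hch : ∀ b : ι, ∃ d ∈ φ ⁻¹' sigmaProduct Γ, d ∈ b.1.1 := fun b => by
    obtain ⟨d, hdb, hdS⟩ := hd.inter_open_nonempty _ (hB.isOpen b.1.2) b.2
    exact ⟨d, hdS, hdb⟩
  choose d hdS hdb using hch
  have hsub : Δ ⊆ ⋃ b : ι, {γ | φ (d b) γ ≠ 0} := by
    rintro γ ⟨x, hx⟩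
    have hopen : IsOpen {y | φ y γ ≠ 0} :=
      isOpen_ne.preimage ((continuous_apply γ).comp hφ)
    obtain ⟨b, hb, hxb, hbsub⟩ := hB.exists_subset_of_mem_open (a := x) hx hopen
    exact Set.mem_iUnion.2 ⟨⟨⟨b, hb⟩, ⟨x, hxb⟩⟩, hbsub (hdb ⟨⟨b, hb⟩, ⟨x, hxb⟩⟩)⟩
  have hι : Cardinal.mk ι ≤ ℵ₁ := (Cardinal.mk_subtype_le _).trans (hBw.le.trans hw)
  have hΔ : Cardinal.mk Δ ≤ Cardinal.mk (ω₁ : Ordinal.{u}).ToType := by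
    rw [Cardinal.mk_toType, Ordinal.card_omega]
    refine (Cardinal.mk_le_mk_of_subset hsub).trans ((Cardinal.mk_iUnion_le _).trans ?_)
    refine Cardinal.mul_le_of_le (Cardinal.aleph0_le_aleph 1) hι ?_
    exact (ciSup_le' fun b => Cardinal.le_aleph0_iff_set_countable.2 (hdS b)).trans
      (Cardinal.aleph0_le_aleph 1)
  obtain ⟨f⟩ := hΔ
  let ψ : K → Δ → ℝ := fun x δ => φ x δ.1
  have hψ : Continuous ψ := continuous_pi fun δ => (continuous_apply δ.1).comp hφ
  have hψinj : Function.Injective ψ := fun x y h => hinj (funext fun γ => by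
    by_cases hγ : γ ∈ Δ
    · exact congrFun h ⟨γ, hγ⟩
    · have hz : ∀ z, φ z γ = 0 := fun z => by
        by_contra hne
        exact hγ ⟨z, hne⟩
      rw [hz, hz])
  have hψS : ψ ⁻¹' sigmaProduct Δ = φ ⁻¹' sigmaProduct Γ := by
    ext x
    have himg : {γ | φ x γ ≠ 0} = Subtype.val '' {δ : Δ | ψ x δ ≠ 0} :=
      Set.ext fun γ => ⟨fun h => ⟨⟨γ, x, h⟩, h, rfl⟩, by rintro ⟨δ, h, rfl⟩; exact h⟩
    change {δ : Δ | ψ x δ ≠ 0}.Countable ↔ {γ | φ x γ ≠ 0}.Countable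
    rw [himg]
    exact ⟨fun h => h.image _,
      Set.countable_of_injective_of_countable_image Subtype.val_injective.injOn⟩
  rw [← hψS] at hd ⊢
  exact exists_retractionSystem_of_enumeration hψ hψinj hd (e := fun δ => (f δ).toOrd.1)
    (fun δ δ' h => f.injective (Ordinal.ToType.mk.symm.injective (Subtype.ext h)))
    fun δ => (f δ).toOrd.2

end Retractions

end SmallValdivia

open SmallValdivia in
theorem theorem3p4 :
    (∀ (K : Type u) [TopologicalSpace K], IsValdiviaCompactum K → weight K ≤ ℵ₁ →
      ∀ S : Set K, Dense S → IsSigmaSubset S →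
        ∃ (T : Type u) (_ : PartialOrder T) (G : GradedTree T)
          (τ : TopologicalSpace (PathSpace T)),
          G.IsGradedBelow ω₁ ∧
          G.IsCompatible τ ∧
          (∀ α < ω₁, TopologicalSpace.MetrizableSpace (G.levelPaths α)) ∧
          (⋃ α < ω₁, G.levelPaths α) = {A : PathSpace T | A.1.Countable} ∧
          ∃ f : K ≃ₜ PathSpace T, f '' S = {A : PathSpace T | A.1.Countable}) ∧
    (∀ (T : Type u) [PartialOrder T] (G : GradedTree T) (τ : TopologicalSpace (PathSpace T)),
      G.IsGradedBelow ω₁ →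
      G.IsCompatible τ →
      (∀ α < ω₁, TopologicalSpace.MetrizableSpace (G.levelPaths α)) →
        IsValdiviaCompactum (PathSpace T) ∧
        weight (PathSpace T) ≤ ℵ₁ ∧
        (⋃ α < ω₁, G.levelPaths α) = {A : PathSpace T | A.1.Countable} ∧
        Dense {A : PathSpace T | A.1.Countable} ∧
        IsSigmaSubset {A : PathSpace T | A.1.Countable}) := by
  constructor
  · intro K _ hK hw S hd hS
    obtain ⟨hcomp, ht2, -⟩ := hK
    obtain ⟨R, hmet, hunion⟩ := exists_retractionSystem hw hd hS
    obtain ⟨τ, f, hτ, hlevel⟩ := R.exists_homeomorph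
    have hcount := GradedTree.iUnion_levelPaths R.gradedTree_isGradedBelow
    refine ⟨R.Node, inferInstance, R.gradedTree, τ, R.gradedTree_isGradedBelow, hτ,
      fun α hα => ?_, hcount, f, ?_⟩
    · have := hmet α hα
      rw [← hlevel α]
      exact (f.image (Set.range (R.retr α))).symm.isEmbedding.metrizableSpace
    · rw [← hcount, ← hunion]
      simp only [Set.image_iUnion, hlevel]
  · intro T _ G τ hG hτ hm
    obtain ⟨φ, hφ, hinj, hpre⟩ := GradedTree.exists_sigma_injection hG hτ hm
    have hd := GradedTree.dense_countable hG hτ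
    have hS : IsSigmaSubset {A : PathSpace T | A.1.Countable} := ⟨_, φ, hφ, hinj, hpre⟩
    have : CompactSpace (PathSpace T) := hτ.1
    refine ⟨⟨hτ.1, hτ.2.1, _, hd, hS⟩, ?_, GradedTree.iUnion_levelPaths hG, hd, hS⟩
    exact (weight_le_of_isInducing (hφ.isClosedEmbedding hinj).isInducing).trans
      mk_option_omega_one_prod
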